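/- Let $\mathbb{D}$ be the open unit disk in $\mathbb{C}$ and let $\beta=(\beta(j))_{j\ge 0}$ be a sequence of positive real numbers with $\liminf_{j\to\infty}\beta(j)^{1/j}=1$. Let $H^2(\beta)$ be the weighted Hardy space of all analytic functions $f$ on $\mathbb{D}$ whose Maclaurin coefficients $\hat f(j)$ satisfy $\|f\|^2:=\sum_{j=0}^\infty|\hat f(j)|^2\beta(j)^2<\infty$. Suppose that $H^2(\beta)$ is automorphism invariant, that is, $f\circ\tau\in H^2(\beta)$ for every $f\in H^2(\beta)$ and every (analytic) automorphism $\tau$ of $\mathbb{D}$. Let $\varphi:\mathbb{D}\to\mathbb{D}$ and $\psi:\mathbb{D}\to\mathbb{C}$ be analytic, and put $C_\varphi f=f\circ\varphi$ and $W_{\psi,\varphi}f=\psi\cdot(f\circ\varphi)$. A function $g$ on $\mathbb{D}$ is a multiplier of $H^2(\beta)$ if $gf\in H^2(\beta)$ for all $f\in H^2(\beta)$. Then: 1. $C_\varphi$ is invertible on $H^2(\beta)$ if and only if $\varphi$ is an automorphism of $\mathbb{D}$. 2. $W_{\psi,\varphi}$ is invertible on $H^2(\beta)$ if and only if $\varphi$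 is an automorphism of $\mathbb{D}$, $\psi$ has no zeros in $\mathbb{D}$, and both $\psi$ and $1/\psi$ are multipliers of $H^2(\beta)$. Both equivalences hold when "invertible" means that the operator maps $H^2(\beta)$ into itself and has a two-sided inverse there as a map, and also when it means that the operator maps $H^2(\beta)$ into itself, is bounded for the norm $\|\cdot\|$, and has a bounded two-sided inverse on $H^2(\beta)$. -/

import Mathlib

open Filter Set
open scoped Complex.UnitDisc

noncomputable section

namespace WeightedHardy

/-- The extension by `0` to `ℂ` of a function on the open unit disk. -/
def zeroExt (f : 𝔻 → ℂ) : ℂ → ℂ :=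
  Function.extend (fun z : 𝔻 => (z : ℂ)) f 0

/-- `f` is an analytic function on the open unit disk. -/
def IsAnalytic (f : 𝔻 → ℂ) : Prop :=
  AnalyticOnNhd ℂ (zeroExt f) (Metric.ball 0 1)

/-- `φ` is an analytic selfmap of the open unit disk. -/
def IsAnalyticSelfmap (φ : 𝔻 → 𝔻) : Prop :=
  IsAnalytic (fun z => (φ z : ℂ))

/-- `φ` is an automorphism of the open unit disk: an analytic selfmap with an analytic
two-sided inverse. -/
def IsAutomorphism (φ : 𝔻 → 𝔻) : Prop :=
  IsAnalyticSelfmap φ ∧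
    ∃ θ : 𝔻 → 𝔻, IsAnalyticSelfmap θ ∧ Function.LeftInverse θ φ ∧ Function.RightInverse θ φ

/-- The `j`-th Maclaurin coefficient of `f`. -/
def coeff (f : 𝔻 → ℂ) (j : ℕ) : ℂ :=
  iteratedDeriv j (zeroExt f) 0 / (j.factorial : ℂ)

/-- The space `H²(β)` of the analytic functions on the disk whose Maclaurin coefficients satisfy
`∑ |f̂(j)|² β(j)² < ∞`. -/
def H2 (β : ℕ → ℝ) : Set (𝔻 → ℂ) :=
  {f | IsAnalytic f ∧ Summable fun j => ‖coeff f j‖ ^ 2 * β j ^ 2}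

/-- The norm of `H²(β)` (meaningful for the elements of `H2 β`, where the series converges). -/
def h2norm (β : ℕ → ℝ) (f : 𝔻 → ℂ) : ℝ :=
  Real.sqrt (∑' j, ‖coeff f j‖ ^ 2 * β j ^ 2)

/-- A set `X` of functions on the disk is automorphism invariant. -/
def AutomorphismInvariant (X : Set (𝔻 → ℂ)) : Prop :=
  ∀ f ∈ X, ∀ τ : 𝔻 → 𝔻, IsAutomorphism τ → f ∘ τ ∈ X

/-- `g` is a multiplier of `X`. -/
def IsMultiplier (X : Set (𝔻 → ℂ)) (g : 𝔻 → ℂ) : Prop :=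
  ∀ f ∈ X, (fun z => g z * f z) ∈ X

/-- The composition operator `f ↦ f ∘ φ`. -/
def compOp (φ : 𝔻 → 𝔻) (f : 𝔻 → ℂ) : 𝔻 → ℂ :=
  f ∘ φ

/-- The weighted composition operator `f ↦ ψ · (f ∘ φ)`. -/
def weightedCompOp (ψ : 𝔻 → ℂ) (φ : 𝔻 → 𝔻) (f : 𝔻 → ℂ) : 𝔻 → ℂ :=
  fun z => ψ z * f (φ z)

/-- `T` maps the set `X` into itself and is invertible as a map `X → X`. -/
def IsInvertibleOn (X : Set (𝔻 → ℂ)) (T : (𝔻 → ℂ) → (𝔻 → ℂ)) : Prop :=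
  MapsTo T X X ∧
    ∃ S : (𝔻 → ℂ) → (𝔻 → ℂ), MapsTo S X X ∧ LeftInvOn S T X ∧ RightInvOn S T X

/-- `T` is bounded on `H²(β)`. -/
def IsBoundedOn (β : ℕ → ℝ) (T : (𝔻 → ℂ) → (𝔻 → ℂ)) : Prop :=
  ∃ C : ℝ, ∀ f ∈ H2 β, h2norm β (T f) ≤ C * h2norm β f

/-- `T` maps `H²(β)` into itself, is bounded there, and has a bounded inverse on `H²(β)`. -/
def IsBoundedlyInvertibleOn (β : ℕ → ℝ) (T : (𝔻 → ℂ) → (𝔻 → ℂ)) : Prop :=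
  MapsTo T (H2 β) (H2 β) ∧ IsBoundedOn β T ∧
    ∃ S : (𝔻 → ℂ) → (𝔻 → ℂ), MapsTo S (H2 β) (H2 β) ∧ IsBoundedOn β S ∧
      LeftInvOn S T (H2 β) ∧ RightInvOn S T (H2 β)

end WeightedHardy

end

open WeightedHardy

noncomputable section

namespace WeightedHardy

open scoped Topology ENNReal NNReal ComplexConjugate

/-! If `ψ · (f ∘ φ)` is invertible, let `g j` be the preimage of `z ^ j`. Then `g j ∘ φ = z ^ j · (g
0 ∘ φ)`, so `φ` is injective, and the identity theorem gives `g j = h ^ j · g 0` with `h = g 1 / g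
0` wherever `g 0 ≠ 0`.

The inverse is bounded by the closed graph theorem (`IsInvertibleOn.exists_equiv`) and point
evaluations are bounded, so `|g j w| ≤ C_w β j`. As `β` is subexponential along a subsequence, `|h|
≤ 1`, and `|g j| ≤ |g 0|` everywhere by density (`norm_le_norm_zero`). A zero of `g 0` would thus be
a common zero of all `g j`, hence of the whole space since polynomials are dense; but the space
contains `1`. So `h` is analytic on the disk with `h ∘ φ = id`, which makes `φ` an automorphism.

Automorphism invariance serves only for the multiplier conditions and the converse. -/

theorem zeroExt_coe (f : 𝔻 → ℂ) (z : 𝔻) : zeroExt f z = f z :=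
  Complex.UnitDisc.coe_injective.extend_apply f 0 z

theorem coe_mem_ball (z : 𝔻) : (z : ℂ) ∈ Metric.ball (0 : ℂ) 1 := by
  simpa using z.norm_lt_one

theorem exists_coe_eq {w : ℂ} (hw : w ∈ Metric.ball (0 : ℂ) 1) : ∃ z : 𝔻, (z : ℂ) = w :=
  ⟨.mk w (by simpa using hw), rfl⟩

theorem IsAnalytic.of_eqOn {f : 𝔻 → ℂ} {F : ℂ → ℂ} (hF : AnalyticOnNhd ℂ F (Metric.ball 0 1))
    (h : ∀ z : 𝔻, F z = f z) : IsAnalytic f := by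
  refine hF.congr Metric.isOpen_ball fun w hw => ?_
  obtain ⟨z, rfl⟩ := exists_coe_eq hw
  rw [h, zeroExt_coe]

/-! ### Power series on the disk -/

theorem IsAnalytic.hasSum {f : 𝔻 → ℂ} (hf : IsAnalytic f) (z : 𝔻) :
    HasSum (fun j => coeff f j * (z : ℂ) ^ j) (f z) := by
  have := Complex.hasSum_taylorSeries_on_ball (f := zeroExt f) (c := 0) (r := 1)
    (by simpa using hf.differentiableOn) (by simpa using z.norm_lt_one)
  rw [zeroExt_coe] at this
  have hterm : (fun j => coeff f j * (z : ℂ) ^ j) =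
      fun j => (j.factorial : ℂ)⁻¹ • ((z : ℂ) - 0) ^ j • iteratedDeriv j (zeroExt f) 0 := by
    funext j
    simp only [coeff, sub_zero, smul_eq_mul]
    ring
  rw [hterm]
  exact this

theorem hasFPowerSeriesOnBall_of_hasSum {f : 𝔻 → ℂ} {a : ℕ → ℂ}
    (h : ∀ z : 𝔻, HasSum (fun j => a j * (z : ℂ) ^ j) (f z)) :
    HasFPowerSeriesOnBall (zeroExt f) (FormalMultilinearSeries.ofScalars ℂ a) 0 1 where
  r_le := by
    refine ENNReal.le_of_forall_nnreal_lt fun r hr => ?_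
    have hr' : ‖((r : ℝ) : ℂ)‖ < 1 := by simpa using hr
    -- The terms of a convergent series tend to zero, here at the point `r`.
    refine FormalMultilinearSeries.le_radius_of_tendsto _ (l := 0) ?_
    have := (h (.mk _ hr')).summable.tendsto_atTop_zero.norm
    simpa using this
  r_pos := one_pos
  hasSum := by
    intro y hy
    obtain ⟨z, rfl⟩ := exists_coe_eq (w := y) (by
      rw [← Metric.eball_ofReal]
      simpa using hy)
    simpa [zeroExt_coe, FormalMultilinearSeries.ofScalars_apply_eq, mul_comm] using h z

theorem isAnalytic_of_hasSum {f : 𝔻 → ℂ} {a : ℕ → ℂ}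
    (h : ∀ z : 𝔻, HasSum (fun j => a j * (z : ℂ) ^ j) (f z)) : IsAnalytic f := by
  have := (hasFPowerSeriesOnBall_of_hasSum h).analyticOnNhd
  simpa [IsAnalytic, ← Metric.eball_ofReal] using this

theorem coeff_of_hasSum {f : 𝔻 → ℂ} {a : ℕ → ℂ}
    (h : ∀ z : 𝔻, HasSum (fun j => a j * (z : ℂ) ^ j) (f z)) (j : ℕ) : coeff f j = a j := by
  have h₁ := hasFPowerSeriesOnBall_of_hasSum h
  have h₂ := h₁.analyticAt.hasFPowerSeriesAt.eq_formalMultilinearSeries h₁.hasFPowerSeriesAt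
  exact congrFun (FormalMultilinearSeries.ofScalars_series_injective ℂ ℂ h₂) j

/-! ### Consequences of the liminf condition -/

section Growth

variable {β : ℕ → ℝ}

theorem pow_rpow_one_div (hβ : ∀ j, 0 < β j) {j : ℕ} (hj : 0 < j) :
    (β j ^ (1 / (j : ℝ))) ^ j = β j := by
  rw [one_div]
  exact Real.rpow_inv_natCast_pow (hβ j).le hj.ne'

theorem eventually_pow_le_weight (hβ : ∀ j, 0 < β j)
    (hlim : liminf (fun j : ℕ => ((β j ^ (1 / (j : ℝ)) : ℝ) : EReal)) atTop = 1)
    {r : ℝ} (h₀ : 0 ≤ r) (h₁ : r < 1) : ∀ᶠ j in atTop, r ^ j ≤ β j := by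
  have hr : (r : EReal) < liminf (fun j : ℕ => ((β j ^ (1 / (j : ℝ)) : ℝ) : EReal)) atTop := by
    rw [hlim]; exact_mod_cast h₁
  filter_upwards [eventually_lt_of_lt_liminf hr, eventually_gt_atTop 0] with j hj hj₀
  rw [← pow_rpow_one_div hβ hj₀]
  exact pow_le_pow_left₀ h₀ (by exact_mod_cast hj.le) j

theorem frequently_weight_le_pow (hβ : ∀ j, 0 < β j)
    (hlim : liminf (fun j : ℕ => ((β j ^ (1 / (j : ℝ)) : ℝ) : EReal)) atTop = 1)
    {r : ℝ} (h₁ : 1 < r) : ∃ᶠ j in atTop, β j ≤ r ^ j := by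
  have hr : liminf (fun j : ℕ => ((β j ^ (1 / (j : ℝ)) : ℝ) : EReal)) atTop < (r : EReal) := by
    rw [hlim]; exact_mod_cast h₁
  refine ((frequently_lt_of_liminf_lt isCobounded_ge_of_top hr).and_eventually
    (eventually_gt_atTop 0)).mono fun j ⟨hj, hj₀⟩ => ?_
  rw [← pow_rpow_one_div hβ hj₀]
  exact pow_le_pow_left₀ (Real.rpow_nonneg (hβ j).le _) (by exact_mod_cast hj.le) j

/-- Every point of the disk has a square-summable reproducing kernel. -/
def HasKernels (β : ℕ → ℝ) : Prop :=
  ∀ z : 𝔻, Summable fun j => (‖(z : ℂ)‖ ^ j / β j) ^ 2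

theorem hasKernels (hβ : ∀ j, 0 < β j)
    (hlim : liminf (fun j : ℕ => ((β j ^ (1 / (j : ℝ)) : ℝ) : EReal)) atTop = 1) :
    HasKernels β := by
  intro z
  -- With `|z| < r < 1` and eventually `r ^ j ≤ β j`, a geometric series of ratio `(|z| / r) ^ 2`
  -- dominates.
  obtain ⟨r, hzr, hr⟩ := exists_between z.norm_lt_one
  have hr₀ : 0 < r := (norm_nonneg _).trans_lt hzr
  have hq : ‖(z : ℂ)‖ / r < 1 := (div_lt_one hr₀).2 hzr
  refine Summable.of_norm_bounded_eventually_nat (g := fun j => ((‖(z : ℂ)‖ / r) ^ 2) ^ j)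
    (summable_geometric_of_lt_one (by positivity) (pow_lt_one₀ (by positivity) hq two_ne_zero)) ?_
  filter_upwards [eventually_pow_le_weight hβ hlim hr₀.le hr] with j hj
  rw [Real.norm_of_nonneg (by positivity)]
  have hpos : 0 < r ^ j := pow_pos hr₀ j
  rw [← pow_mul (_ / r), mul_comm 2 j, pow_mul (_ / r), div_pow _ r]
  exact pow_le_pow_left₀ (div_nonneg (by positivity) (hβ j).le)
    (div_le_div_of_nonneg_left (by positivity) hpos hj) 2

/-- A weight has subexponential growth along a subsequence. -/
def HasSlowGrowth (β : ℕ → ℝ) : Prop :=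
  ∀ r : ℝ, 1 < r → ∃ᶠ j in atTop, β j ≤ r ^ j

/-- Otherwise pick `1 < s < r`: infinitely often `β j ≤ s ^ j`, while `(r / s) ^ j` is unbounded. -/
theorem HasSlowGrowth.le_one {β : ℕ → ℝ} (h : HasSlowGrowth β) {r c C : ℝ}
    (hc : 0 < c) (hC : 0 ≤ C) (hle : ∀ j, r ^ j * c ≤ C * β j) : r ≤ 1 := by
  by_contra! h₁
  obtain ⟨s, hs, hsr⟩ := exists_between h₁
  have hs₀ : 0 < s := one_pos.trans hs
  have hlim := tendsto_pow_atTop_atTop_of_one_lt ((one_lt_div hs₀).2 hsr)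
  obtain ⟨j, hj, hj'⟩ := ((h s hs).and_eventually (hlim.eventually_gt_atTop (C / c))).exists
  rw [div_pow, div_lt_div_iff₀ hc (by positivity)] at hj'
  have := mul_le_mul_of_nonneg_left hj hC
  linarith [hle j]

end Growth

/-! ### Unitary model on square-summable sequences -/

section Model

variable {β : ℕ → ℝ}

/-- The space of square-summable complex sequences. -/
abbrev SqSummable : Type := lp (fun _ : ℕ => ℂ) 2

theorem memℓp_two_iff {a : ℕ → ℂ} : Memℓp a 2 ↔ Summable fun j => ‖a j‖ ^ 2 := by
  simpa using memℓp_gen_iff (p := 2) (f := a) (by simp)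

/-- The reproducing kernel of the weighted Hardy space at a point, as a sequence. -/
def kernel (hK : HasKernels β) (z : 𝔻) : SqSummable :=
  ⟨fun j => conj (z : ℂ) ^ j / β j, memℓp_two_iff.2 <| by
    simpa [div_pow] using hK z⟩

/-- The function on the disk with Maclaurin coefficients `x j / β j`. -/
def ofSeq (hK : HasKernels β) : SqSummable →ₗ[ℂ] (𝔻 → ℂ) where
  toFun x z := inner ℂ (kernel hK z) x
  map_add' x y := by ext z; simp
  map_smul' c x := by ext z; simp

variable (hK : HasKernels β)

theorem continuous_ofSeq_apply (z : 𝔻) : Continuous fun x => ofSeq hK x z :=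
  continuous_const.inner continuous_id

theorem norm_ofSeq_apply_le (x : SqSummable) (z : 𝔻) :
    ‖ofSeq hK x z‖ ≤ ‖kernel hK z‖ * ‖x‖ :=
  norm_inner_le_norm (𝕜 := ℂ) (kernel hK z) x

theorem ofSeq_hasSum (x : SqSummable) (z : 𝔻) :
    HasSum (fun j => x j / β j * (z : ℂ) ^ j) (ofSeq hK x z) := by
  have hterm : (fun j => x j / β j * (z : ℂ) ^ j) =
      fun j => inner ℂ (kernel hK z j) (x j) := by
    funext j
    simp [kernel]
    ring
  rw [hterm]
  exact lp.hasSum_inner (kernel hK z) x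

theorem isAnalytic_ofSeq (x : SqSummable) : IsAnalytic (ofSeq hK x) :=
  isAnalytic_of_hasSum (ofSeq_hasSum hK x)

theorem coeff_ofSeq (x : SqSummable) (j : ℕ) : coeff (ofSeq hK x) j = x j / β j :=
  coeff_of_hasSum (ofSeq_hasSum hK x) j

variable (hβ : ∀ j, 0 < β j)
include hβ

theorem norm_coeff_ofSeq (x : SqSummable) (j : ℕ) :
    ‖coeff (ofSeq hK x) j‖ ^ 2 * β j ^ 2 = ‖x j‖ ^ 2 := by
  have := (hβ j).ne'
  simp [coeff_ofSeq, div_pow]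
  field_simp

theorem ofSeq_mem (x : SqSummable) : ofSeq hK x ∈ H2 β :=
  ⟨isAnalytic_ofSeq hK x, by
    simpa only [norm_coeff_ofSeq hK hβ] using memℓp_two_iff.1 (lp.memℓp x)⟩

theorem exists_ofSeq_eq {f : 𝔻 → ℂ} (hf : f ∈ H2 β) : ∃ x, ofSeq hK x = f := by
  refine ⟨⟨fun j => coeff f j * β j, memℓp_two_iff.2 ?_⟩, ?_⟩
  · simpa [mul_pow] using hf.2
  · ext z
    refine (ofSeq_hasSum hK _ z).unique ?_
    convert hf.1.hasSum z using 3 with j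
    have : (β j : ℂ) ≠ 0 := by exact_mod_cast (hβ j).ne'
    simp [this]

theorem ofSeq_injective : Function.Injective (ofSeq hK) := by
  intro x y h
  ext j
  have : (β j : ℂ) ≠ 0 := by exact_mod_cast (hβ j).ne'
  have h' := coeff_ofSeq hK x j
  rw [h, coeff_ofSeq, div_left_inj' this] at h'
  exact h'.symm

theorem h2norm_ofSeq (x : SqSummable) : h2norm β (ofSeq hK x) = ‖x‖ := by
  have := lp.norm_rpow_eq_tsum (p := 2) (by simp) x
  simp only [ENNReal.toReal_ofNat, Real.rpow_ofNat] at this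
  simp_rw [h2norm, norm_coeff_ofSeq hK hβ, ← this]
  exact Real.sqrt_sq (norm_nonneg x)

theorem ofSeq_single (j : ℕ) (z : 𝔻) :
    ofSeq hK (lp.single 2 j (β j : ℂ)) z = (z : ℂ) ^ j := by
  have : (β j : ℂ) ≠ 0 := by exact_mod_cast (hβ j).ne'
  simp [ofSeq, lp.inner_single_right, kernel]
  field_simp

end Model

/-! ### Identity theorem and maximum principle -/

section ComplexAnalysis

theorem isPreconnected_ball : IsPreconnected (Metric.ball (0 : ℂ) 1) :=
  (convex_ball 0 1).isPreconnected

theorem IsAnalytic.continuous {f : 𝔻 → ℂ} (hf : IsAnalytic f) : Continuous f := by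
  have h : f = zeroExt f ∘ ((↑) : 𝔻 → ℂ) := by ext z; simp [zeroExt_coe]
  rw [h]
  exact hf.continuousOn.comp_continuous Complex.UnitDisc.continuous_coe coe_mem_ball

theorem isAnalytic_coe : IsAnalytic fun z => (z : ℂ) :=
  .of_eqOn analyticOnNhd_id fun _ => rfl

theorem IsAnalytic.comp {f : 𝔻 → ℂ} (hf : IsAnalytic f) {φ : 𝔻 → 𝔻} (hφ : IsAnalyticSelfmap φ) :
    IsAnalytic fun z => f (φ z) := by
  refine .of_eqOn (F := zeroExt f ∘ zeroExt fun z => (φ z : ℂ)) (AnalyticOnNhd.comp hf hφ ?_) ?_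
  · intro w hw
    obtain ⟨z, rfl⟩ := exists_coe_eq hw
    rw [zeroExt_coe]
    exact coe_mem_ball _
  · intro z
    simp [zeroExt_coe]

theorem IsAnalytic.mul {f g : 𝔻 → ℂ} (hf : IsAnalytic f) (hg : IsAnalytic g) :
    IsAnalytic fun z => f z * g z :=
  .of_eqOn (AnalyticOnNhd.mul hf hg) fun z => by simp [zeroExt_coe]

theorem IsAnalytic.pow {f : 𝔻 → ℂ} (hf : IsAnalytic f) (n : ℕ) : IsAnalytic fun z => f z ^ n :=
  .of_eqOn (AnalyticOnNhd.pow hf n) fun z => by simp [zeroExt_coe]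

theorem IsAnalytic.div {f g : 𝔻 → ℂ} (hf : IsAnalytic f) (hg : IsAnalytic g)
    (h₀ : ∀ z, g z ≠ 0) : IsAnalytic fun z => f z / g z := by
  refine .of_eqOn (AnalyticOnNhd.div hf hg ?_) fun z => by simp [zeroExt_coe]
  intro w hw
  obtain ⟨z, rfl⟩ := exists_coe_eq hw
  rw [zeroExt_coe]
  exact h₀ z

/-- The identity theorem on the range of an injective analytic selfmap. -/
theorem IsAnalytic.eq_of_comp_eq {f g : 𝔻 → ℂ} (hf : IsAnalytic f) (hg : IsAnalytic g)
    {φ : 𝔻 → 𝔻} (hφ : IsAnalyticSelfmap φ) (hinj : Function.Injective φ)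
    (h : ∀ z, f (φ z) = g (φ z)) (w : 𝔻) : f w = g w := by
  have h₀ : (0 : ℂ) ∈ Metric.ball (0 : ℂ) 1 := by simp
  have hφ₀ : zeroExt (fun z => (φ z : ℂ)) 0 = φ 0 := by
    simpa using zeroExt_coe (fun z => (φ z : ℂ)) 0
  have hball : ∀ᶠ u in 𝓝[≠] (0 : ℂ), u ∈ Metric.ball (0 : ℂ) 1 :=
    nhdsWithin_le_nhds (Metric.isOpen_ball.mem_nhds h₀)
  have htend : Tendsto (zeroExt fun z => (φ z : ℂ)) (𝓝[≠] 0) (𝓝[≠] (φ 0 : ℂ)) := by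
    refine tendsto_nhdsWithin_iff.2 ⟨?_, ?_⟩
    · rw [← hφ₀]
      exact (hφ 0 h₀).continuousAt.tendsto.mono_left nhdsWithin_le_nhds
    · filter_upwards [hball, self_mem_nhdsWithin] with u hu hu₀ hmem
      obtain ⟨z, rfl⟩ := exists_coe_eq hu
      rw [zeroExt_coe, mem_singleton_iff, Complex.UnitDisc.coe_inj] at hmem
      exact hu₀ (by simpa using hinj hmem)
  have hfreq : ∃ᶠ v in 𝓝[≠] (φ 0 : ℂ), zeroExt f v = zeroExt g v := by
    refine htend.frequently (Eventually.frequently ?_)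
    filter_upwards [hball] with u hu
    obtain ⟨z, rfl⟩ := exists_coe_eq hu
    simp only [zeroExt_coe, h]
  have := AnalyticOnNhd.eqOn_of_preconnected_of_frequently_eq hf hg isPreconnected_ball
    (coe_mem_ball (φ 0)) hfreq (coe_mem_ball w)
  simpa only [zeroExt_coe] using this

theorem IsAnalytic.dense_ne_zero {f : 𝔻 → ℂ} (hf : IsAnalytic f) {a : 𝔻} (ha : f a ≠ 0) :
    Dense {z | f z ≠ 0} := by
  intro b
  rw [mem_closure_iff_frequently]
  intro hb
  simp only [ne_eq, mem_ofPred_eq, not_not] at hb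
  rw [Complex.UnitDisc.isEmbedding_coe.nhds_eq_comap, eventually_comap] at hb
  refine ha ?_
  have := AnalyticOnNhd.eqOn_zero_of_preconnected_of_eventuallyEq_zero hf isPreconnected_ball
    (coe_mem_ball b) (by
      filter_upwards [hb, Metric.isOpen_ball.mem_nhds (coe_mem_ball b)] with u hu hu'
      obtain ⟨z, rfl⟩ := exists_coe_eq hu'
      rw [zeroExt_coe]
      exact hu z rfl) (coe_mem_ball a)
  simpa [zeroExt_coe] using this

/-- An analytic function bounded by `1` which vanishes somewhere is a selfmap of the disk. -/
theorem IsAnalytic.norm_lt_one {h : 𝔻 → ℂ} (hh : IsAnalytic h) (hle : ∀ w, ‖h w‖ ≤ 1) {b : 𝔻}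
    (hb : h b = 0) (w : 𝔻) : ‖h w‖ < 1 := by
  refine (hle w).lt_of_ne fun hw => ?_
  have := Complex.norm_eqOn_of_isPreconnected_of_isMaxOn isPreconnected_ball Metric.isOpen_ball
    hh.differentiableOn (coe_mem_ball w) (by
      intro u hu
      obtain ⟨z, rfl⟩ := exists_coe_eq hu
      simpa [zeroExt_coe, hw] using hle z) (coe_mem_ball b)
  simp [zeroExt_coe, hb, hw] at this

/-- Since `h` vanishes at `φ 0`, the maximum principle makes it a selfmap; the identity theorem on
the range of `φ` makes it a right inverse too. -/
theorem isAutomorphism_of_leftInverse {φ : 𝔻 → 𝔻} (hφ : IsAnalyticSelfmap φ) {h : 𝔻 → ℂ}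
    (hh : IsAnalytic h) (hle : ∀ w, ‖h w‖ ≤ 1) (hφh : ∀ z, h (φ z) = z) : IsAutomorphism φ := by
  have hlt := hh.norm_lt_one hle (b := φ 0) (by simp [hφh])
  let θ : 𝔻 → 𝔻 := fun w => .mk (h w) (hlt w)
  have hθ : IsAnalyticSelfmap θ := hh
  have hleft : Function.LeftInverse θ φ := fun z =>
    Complex.UnitDisc.coe_injective (hφh z)
  refine ⟨hφ, θ, hθ, hleft, fun w => Complex.UnitDisc.coe_injective ?_⟩
  exact (IsAnalytic.comp hφ hθ).eq_of_comp_eq isAnalytic_coe hφ hleft.injective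
    (fun z => by rw [hleft z]) w

end ComplexAnalysis

section Preimages

/-! Families `g j` that a weighted composition operator maps to the monomials. -/

variable {β : ℕ → ℝ} {ψ : 𝔻 → ℂ} {φ : 𝔻 → 𝔻} {g : ℕ → 𝔻 → ℂ}

theorem weight_ne_zero (hg : ∀ j z, ψ z * g j (φ z) = (z : ℂ) ^ j) (z : 𝔻) : ψ z ≠ 0 :=
  fun h => by simpa [h] using hg 0 z

theorem comp_eq_pow_mul (hg : ∀ j z, ψ z * g j (φ z) = (z : ℂ) ^ j) (j : ℕ) (z : 𝔻) :
    g j (φ z) = (z : ℂ) ^ j * g 0 (φ z) := by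
  refine mul_left_cancel₀ (weight_ne_zero hg z) ?_
  have := hg 0 z
  rw [hg j z]
  linear_combination -(z : ℂ) ^ j * this

theorem comp_zero_ne_zero (hg : ∀ j z, ψ z * g j (φ z) = (z : ℂ) ^ j) (z : 𝔻) :
    g 0 (φ z) ≠ 0 :=
  fun h => by simpa [h] using hg 0 z

theorem injective_of_preimages (hg : ∀ j z, ψ z * g j (φ z) = (z : ℂ) ^ j) :
    Function.Injective φ := by
  intro z w hzw
  have hz := comp_eq_pow_mul hg 1 z
  rw [hzw, comp_eq_pow_mul hg 1 w] at hz
  simpa using (mul_right_cancel₀ (comp_zero_ne_zero hg w) hz).symm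

variable (hφ : IsAnalyticSelfmap φ) (hg : ∀ j z, ψ z * g j (φ z) = (z : ℂ) ^ j)
  (ha : ∀ j, IsAnalytic (g j))
include hφ hg ha

/-- Denominators are cleared so that the identity theorem applies across the zeros of `g 0`. -/
theorem mul_pow_eq (j : ℕ) (w : 𝔻) : g j w * g 0 w ^ j = g 1 w ^ j * g 0 w := by
  refine ((ha j).mul ((ha 0).pow j)).eq_of_comp_eq (((ha 1).pow j).mul (ha 0)) hφ
    (injective_of_preimages hg) (fun z => ?_) w
  rw [comp_eq_pow_mul hg j, comp_eq_pow_mul hg 1]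
  ring

theorem eq_div_pow_mul (j : ℕ) {w : 𝔻} (hw : g 0 w ≠ 0) :
    g j w = (g 1 w / g 0 w) ^ j * g 0 w := by
  have := mul_pow_eq hφ hg ha j w
  rw [div_pow, div_mul_eq_mul_div, eq_div_iff (pow_ne_zero j hw), this]

theorem norm_le_norm_zero (hβ : HasSlowGrowth β)
    (hbound : ∀ w, ∃ C, 0 ≤ C ∧ ∀ j, ‖g j w‖ ≤ C * β j) (j : ℕ) (w : 𝔻) :
    ‖g j w‖ ≤ ‖g 0 w‖ := by
  have hclosed : IsClosed {w | ‖g j w‖ ≤ ‖g 0 w‖} :=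
    isClosed_le (ha j).continuous.norm (ha 0).continuous.norm
  refine hclosed.closure_subset_iff.2 (fun v hv => ?_)
    ((ha 0).dense_ne_zero (comp_zero_ne_zero hg 0) w)
  obtain ⟨C, hC, hle⟩ := hbound v
  have h₁ : ‖g 1 v / g 0 v‖ ≤ 1 := by
    refine hβ.le_one (norm_pos_iff.2 hv) hC fun i => ?_
    rw [← norm_pow, ← norm_mul, ← eq_div_pow_mul hφ hg ha i hv]
    exact hle i
  rw [mem_ofPred_eq, eq_div_pow_mul hφ hg ha j hv, norm_mul, norm_pow]
  exact mul_le_of_le_one_left (norm_nonneg _) (pow_le_one₀ (norm_nonneg _) h₁)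

theorem isAutomorphism_of_preimages (hle : ∀ w, ‖g 1 w‖ ≤ ‖g 0 w‖) (h₀ : ∀ w, g 0 w ≠ 0) :
    IsAutomorphism φ := by
  refine isAutomorphism_of_leftInverse hφ ((ha 1).div (ha 0) h₀) (fun w => ?_) fun z => ?_
  · rw [norm_div]
    exact div_le_one_of_le₀ (hle w) (norm_nonneg _)
  · rw [comp_eq_pow_mul hg 1, mul_div_cancel_right₀ _ (h₀ _), pow_one]

end Preimages

/-! ### Invertible operators: boundedness and the symbol -/

section Operator

variable {β : ℕ → ℝ} {ψ : 𝔻 → ℂ} {φ : 𝔻 → 𝔻} (hK : HasKernels β) (hβ : ∀ j, 0 < β j)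
include hβ

/-- An invertible weighted composition operator induces an isomorphism of the sequence space. -/
theorem IsInvertibleOn.exists_equiv (h : IsInvertibleOn (H2 β) (weightedCompOp ψ φ)) :
    ∃ e : SqSummable ≃L[ℂ] SqSummable,
      ∀ x, ofSeq hK (e x) = weightedCompOp ψ φ (ofSeq hK x) := by
  obtain ⟨hT, S, hS, hST, hTS⟩ := h
  have hinj := ofSeq_injective hK hβ
  choose A hA using fun x => exists_ofSeq_eq hK hβ (hT (ofSeq_mem hK hβ x))
  let L : SqSummable →ₗ[ℂ] SqSummable :=
    { toFun := A
      map_add' := fun x y => hinj <| by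
        ext z; simp [hA, weightedCompOp, mul_add]
      map_smul' := fun c x => hinj <| by
        ext z; simp [hA, weightedCompOp, mul_left_comm] }
  have hL : Continuous L := by
    -- The graph is closed because point evaluations are continuous and separate points.
    refine L.continuous_of_seq_closed_graph fun u x y hu hLu => hinj ?_
    ext z
    refine tendsto_nhds_unique
      (((continuous_ofSeq_apply hK z).tendsto y).comp hLu) ?_
    have h₁ := (((continuous_ofSeq_apply hK (φ z)).tendsto x).comp hu).const_mul (ψ z)
    change Tendsto (fun n => ofSeq hK (A (u n)) z) atTop (𝓝 (ofSeq hK (A x) z))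
    simp only [hA]
    exact h₁
  have hbij : Function.Bijective L := by
    refine ⟨fun x y hxy => hinj ?_, fun y => ?_⟩
    · rw [← hST (ofSeq_mem hK hβ x), ← hST (ofSeq_mem hK hβ y), ← hA, ← hA]
      exact congrArg (fun v => S (ofSeq hK v)) hxy
    · obtain ⟨x, hx⟩ := exists_ofSeq_eq hK hβ (hS (ofSeq_mem hK hβ y))
      refine ⟨x, hinj ?_⟩
      change ofSeq hK (A x) = _
      rw [hA, hx, hTS (ofSeq_mem hK hβ y)]
  refine ⟨ContinuousLinearEquiv.ofBijective ⟨L, hL⟩ (LinearMap.ker_eq_bot.2 hbij.1)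
    (LinearMap.range_eq_top.2 hbij.2), hA⟩

include hK

theorem IsInvertibleOn.isBoundedlyInvertibleOn
    (h : IsInvertibleOn (H2 β) (weightedCompOp ψ φ)) :
    IsBoundedlyInvertibleOn β (weightedCompOp ψ φ) := by
  obtain ⟨e, he⟩ := h.exists_equiv hK hβ
  obtain ⟨hT, S, hS, hST, hTS⟩ := h
  refine ⟨hT, ⟨‖(e : SqSummable →L[ℂ] SqSummable)‖, fun f hf => ?_⟩, S, hS,
    ⟨‖(e.symm : SqSummable →L[ℂ] SqSummable)‖, fun f hf => ?_⟩, hST, hTS⟩ <;>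
  obtain ⟨x, rfl⟩ := exists_ofSeq_eq hK hβ hf
  · rw [← he, h2norm_ofSeq hK hβ, h2norm_ofSeq hK hβ]
    exact (e : SqSummable →L[ℂ] SqSummable).le_opNorm x
  · have : S (ofSeq hK x) = ofSeq hK (e.symm x) := by
      rw [← hST (ofSeq_mem hK hβ (e.symm x)), ← he, e.apply_symm_apply]
    rw [this, h2norm_ofSeq hK hβ, h2norm_ofSeq hK hβ]
    exact (e.symm : SqSummable →L[ℂ] SqSummable).le_opNorm x

/-- The constant `1` lies in the range, whose members vanish at the zeros of `ψ`. -/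
theorem IsInvertibleOn.weight_ne_zero (h : IsInvertibleOn (H2 β) (weightedCompOp ψ φ)) (z : 𝔻) :
    ψ z ≠ 0 := by
  intro hz
  obtain ⟨e, he⟩ := h.exists_equiv hK hβ
  have := congrFun (he (e.symm (lp.single 2 0 (β 0 : ℂ)))) z
  rw [e.apply_symm_apply, ofSeq_single hK hβ] at this
  simp [weightedCompOp, hz] at this

theorem IsInvertibleOn.isAutomorphism (hslow : HasSlowGrowth β) (hφ : IsAnalyticSelfmap φ)
    (h : IsInvertibleOn (H2 β) (weightedCompOp ψ φ)) : IsAutomorphism φ := by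
  obtain ⟨e, he⟩ := h.exists_equiv hK hβ
  let T : SqSummable →L[ℂ] SqSummable := e.symm
  let g : ℕ → 𝔻 → ℂ := fun j => ofSeq hK (T (lp.single 2 j (β j : ℂ)))
  have hg : ∀ j z, ψ z * g j (φ z) = (z : ℂ) ^ j := fun j z => by
    have := congrFun (he (T (lp.single 2 j (β j : ℂ)))) z
    rw [show e (T (lp.single 2 j (β j : ℂ))) = _ from e.apply_symm_apply _,
      ofSeq_single hK hβ] at this
    exact this.symm
  have ha : ∀ j, IsAnalytic (g j) := fun j => isAnalytic_ofSeq hK _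
  have hbound : ∀ w, ∃ C, 0 ≤ C ∧ ∀ j, ‖g j w‖ ≤ C * β j := fun w => by
    refine ⟨‖kernel hK w‖ * ‖T‖, by positivity, fun j => ?_⟩
    refine (norm_ofSeq_apply_le hK _ w).trans ?_
    rw [mul_assoc]
    refine mul_le_mul_of_nonneg_left ((T.le_opNorm _).trans_eq ?_) (norm_nonneg _)
    rw [lp.norm_single (by simp), Complex.norm_real, Real.norm_of_nonneg (hβ j).le]
  have hle := norm_le_norm_zero hφ hg ha hslow hbound
  refine isAutomorphism_of_preimages hφ hg ha (hle 1) fun w hw => ?_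
  have hgw : ∀ j, g j w = 0 := fun j => by simpa [hw] using hle j w
  -- Evaluation at `w` after the inverse kills every monomial, hence everything, yet it takes the
  -- value `1` on the image of the constant `1`.
  let ev : SqSummable →L[ℂ] ℂ := (innerSL ℂ (kernel hK w)).comp T
  have hev : ∀ x, ev x = ofSeq hK (T x) w := fun x => rfl
  have hsingle : ∀ (x : SqSummable) j, ev (lp.single 2 j (x j)) = 0 := fun x j => by
    have hj : (β j : ℂ) ≠ 0 := by exact_mod_cast (hβ j).ne'
    have : lp.single (E := fun _ : ℕ => ℂ) 2 j (x j) = (x j / β j) • lp.single 2 j (β j : ℂ) := by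
      rw [← lp.single_smul, smul_eq_mul, div_mul_cancel₀ _ hj]
    rw [this, map_smul, hev, show ofSeq hK (T (lp.single 2 j (β j : ℂ))) w = 0 from hgw j,
      smul_zero]
  have hzero : ∀ x, ev x = 0 := fun x => by
    have := ev.hasSum (lp.hasSum_single (by simp) x)
    simp only [hsingle] at this
    exact this.unique hasSum_zero
  have := hzero (e (lp.single 2 0 (β 0 : ℂ)))
  rw [hev, show T (e (lp.single 2 0 (β 0 : ℂ))) = _ from e.symm_apply_apply _,
    ofSeq_single hK hβ] at this
  simp at this

end Operator

/-! ### Multiplier conditions and the converse -/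

section Multipliers

variable {X : Set (𝔻 → ℂ)} {ψ : 𝔻 → ℂ} {φ : 𝔻 → 𝔻}

/-- `ψ · f` is the image of `f ∘ φ⁻¹`. -/
theorem IsInvertibleOn.isMultiplier (hX : AutomorphismInvariant X) (hφ : IsAutomorphism φ)
    (h : IsInvertibleOn X (weightedCompOp ψ φ)) : IsMultiplier X ψ := by
  obtain ⟨hφ', θ, hθ, hl, hr⟩ := hφ
  intro f hf
  convert h.1 (hX f hf θ ⟨hθ, φ, hφ', hr, hl⟩) using 1
  ext z
  simp [weightedCompOp, hl z]

/-- From `f = ψ · (S f ∘ φ)` one gets `f / ψ = S f ∘ φ`. -/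
theorem IsInvertibleOn.isMultiplier_inv (hX : AutomorphismInvariant X) (hφ : IsAutomorphism φ)
    (hψ : ∀ z, ψ z ≠ 0) (h : IsInvertibleOn X (weightedCompOp ψ φ)) :
    IsMultiplier X fun z => 1 / ψ z := by
  obtain ⟨-, S, hS, -, hTS⟩ := h
  intro f hf
  convert hX _ (hS hf) φ hφ using 1
  ext z
  have := congrFun (hTS hf) z
  simp only [weightedCompOp] at this
  rw [← this, Function.comp_apply, ← mul_assoc, one_div_mul_cancel (hψ z), one_mul]

theorem isInvertibleOn_weightedCompOp (hX : AutomorphismInvariant X) (hφ : IsAutomorphism φ)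
    (hm : IsMultiplier X ψ) (hψ : ∀ z, ψ z ≠ 0) (hm' : IsMultiplier X fun z => 1 / ψ z) :
    IsInvertibleOn X (weightedCompOp ψ φ) := by
  have hφ₀ := hφ
  obtain ⟨hφ', θ, hθ, hl, hr⟩ := hφ
  refine ⟨fun f hf => hm _ (hX f hf φ hφ₀), fun f => (fun z => 1 / ψ z * f z) ∘ θ,
    fun f hf => hX _ (hm' f hf) θ ⟨hθ, φ, hφ', hr, hl⟩, fun f _ => ?_, fun f _ => ?_⟩
  · ext z
    simp [weightedCompOp, hr z, hψ]
  · ext z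
    simp [weightedCompOp, hl z, hψ]

theorem IsBoundedlyInvertibleOn.isInvertibleOn {β : ℕ → ℝ} {T : (𝔻 → ℂ) → (𝔻 → ℂ)}
    (h : IsBoundedlyInvertibleOn β T) : IsInvertibleOn (H2 β) T := by
  obtain ⟨hT, -, S, hS, -, hST, hTS⟩ := h
  exact ⟨hT, S, hS, hST, hTS⟩

end Multipliers

theorem isInvertibleOn_weightedCompOp_iff {β : ℕ → ℝ} (hβ : ∀ j, 0 < β j) (hK : HasKernels β)
    (hslow : HasSlowGrowth β) (hinv : AutomorphismInvariant (H2 β)) {φ : 𝔻 → 𝔻}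
    (hφ : IsAnalyticSelfmap φ) (ψ : 𝔻 → ℂ) :
    IsInvertibleOn (H2 β) (weightedCompOp ψ φ) ↔
      IsAutomorphism φ ∧ IsMultiplier (H2 β) ψ ∧
        (∀ z, ψ z ≠ 0) ∧ IsMultiplier (H2 β) (fun z => 1 / ψ z) := by
  refine ⟨fun h => ?_, fun ⟨h₁, h₂, h₃, h₄⟩ => isInvertibleOn_weightedCompOp hinv h₁ h₂ h₃ h₄⟩
  have hauto := h.isAutomorphism hK hβ hslow hφ
  have hne := h.weight_ne_zero hK hβ
  exact ⟨hauto, h.isMultiplier hinv hauto, hne, h.isMultiplier_inv hinv hauto hne⟩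

end WeightedHardy
end

theorem theorem3p3 (β : ℕ → ℝ) (hβ : ∀ j, 0 < β j)
    (hlim : liminf (fun j : ℕ => ((β j ^ (1 / (j : ℝ)) : ℝ) : EReal)) atTop = 1)
    (hinv : AutomorphismInvariant (H2 β))
    (φ : 𝔻 → 𝔻) (hφ : IsAnalyticSelfmap φ) (ψ : 𝔻 → ℂ) (hψ : IsAnalytic ψ) :
    ((IsInvertibleOn (H2 β) (compOp φ) ↔ IsAutomorphism φ) ∧
      (IsBoundedlyInvertibleOn β (compOp φ) ↔ IsAutomorphism φ)) ∧
    ((IsInvertibleOn (H2 β) (weightedCompOp ψ φ) ↔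
        IsAutomorphism φ ∧ IsMultiplier (H2 β) ψ ∧
          (∀ z, ψ z ≠ 0) ∧ IsMultiplier (H2 β) (fun z => 1 / ψ z)) ∧
      (IsBoundedlyInvertibleOn β (weightedCompOp ψ φ) ↔
        IsAutomorphism φ ∧ IsMultiplier (H2 β) ψ ∧
          (∀ z, ψ z ≠ 0) ∧ IsMultiplier (H2 β) (fun z => 1 / ψ z))) := by
  have hK := hasKernels hβ hlim
  have hslow : HasSlowGrowth β := fun r hr => frequently_weight_le_pow hβ hlim hr
  have hiff := isInvertibleOn_weightedCompOp_iff hβ hK hslow hinv hφ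
  have hbdd (χ : 𝔻 → ℂ) : IsBoundedlyInvertibleOn β (weightedCompOp χ φ) ↔
      IsInvertibleOn (H2 β) (weightedCompOp χ φ) :=
    ⟨fun h => h.isInvertibleOn, fun h => h.isBoundedlyInvertibleOn hK hβ⟩
  have hcomp : compOp φ = weightedCompOp 1 φ := by
    ext f z
    simp [compOp, weightedCompOp]
  have hone : IsInvertibleOn (H2 β) (weightedCompOp 1 φ) ↔ IsAutomorphism φ := by
    rw [hiff]
    simp [IsMultiplier]
  rw [hcomp, hbdd, hbdd, hone, hiff]
  exact ⟨⟨Iff.rfl, Iff.rfl⟩, Iff.rfl, Iff.rfl⟩
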